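/- Let $d\ge 1$ and let $\Gamma$ be the free group on generators $a_1,\dots,a_d$, with $a_{-i}=a_i^{-1}$ and identity $e$. On $\ell^2(\Gamma)$ (complex-valued functions, counting measure) let $\Delta_\Gamma$ be the bounded operator $$(\Delta_\Gamma\psi)(g)=\sum_{-d\le i\le d,\ i\ne 0}\bigl[\psi(ga_i)-\psi(g)\bigr],$$ let $\gamma=2d-2\sqrt{2d-1}$, and let $\pi_\Gamma(t)=(e^{t\Delta_\Gamma}\delta_e)(e)$ be the heat kernel on the diagonal. a) $\gamma\ge 0$; the operator $-\Delta_\Gamma$ is self-adjoint, its spectrum is the interval $[\gamma,\gamma+4\sqrt{2d-1}]$, and the spectrum is purely absolutely continuous: for every $\psi\in\ell^2(\Gamma)$ the spectral measure of $-\Delta_\Gamma$ at $\psi$ is absolutely continuous with respect to Lebesgue measure. b) There is a constant $c_1>0$ such that $\pi_\Gamma(t)\to c_1$ as $t\to 0^+$, and, if $d\ge 2$, there is a constant $c_2>0$ such that $$\pi_\Gamma(t)\sim c_2\,\frac{e^{-\gamma t}}{t^{3/2}}\quad\text{as } t\to\infty .$$ The constants depend only on $d$. -/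

import Mathlib

open scoped ENNReal BoundedContinuousFunction

noncomputable section

/-! ### Spectral measures and absolute continuity of the spectrum -/

section Spectral

variable {E : Type*} [NormedAddCommGroup E] [InnerProductSpace ℂ E] [CompleteSpace E]

/-- The finite Borel measure `μ` on `ℝ` is the spectral measure of the bounded self-adjoint
operator `T` at the vector `ψ`: `⟨ψ, f(T) ψ⟩ = ∫ f dμ` for every bounded continuous `f`, where
`f(T)` is given by the continuous functional calculus. (These identities determine `μ`.) -/
structure IsSpectralMeasure (T : E →L[ℂ] E) (ψ : E) (μ : MeasureTheory.Measure ℝ) : Prop where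
  isFiniteMeasure : MeasureTheory.IsFiniteMeasure μ
  integral_eq : ∀ f : ℝ →ᵇ ℝ,
    inner ℂ ψ (cfc (fun x : ℝ => f x) T ψ) = ((∫ x, f x ∂μ : ℝ) : ℂ)

/-- The bounded operator `T` is self-adjoint and its spectrum is purely absolutely continuous:
the spectral measure of every vector is absolutely continuous with respect to Lebesgue
measure. -/
structure HasPurelyACSpectrum (T : E →L[ℂ] E) : Prop where
  isSelfAdjoint : IsSelfAdjoint T
  spectralMeasure_ac : ∀ ψ : E, ∃ μ : MeasureTheory.Measure ℝ,
    IsSpectralMeasure T ψ μ ∧ μ.AbsolutelyContinuous MeasureTheory.volume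

end Spectral

/-! ### The Laplacian of the free group -/

/-- The Hilbert space `ℓ²(Γ)` of complex square-summable functions on the group `Γ`
(with the counting measure). -/
abbrev EllTwo (Γ : Type*) : Type _ := lp (fun _ : Γ => ℂ) 2

theorem memlp_translate {Γ : Type*} [Group Γ] (a : Γ) (ψ : EllTwo Γ) :
    Memℓp (fun g : Γ => ψ (g * a)) 2 := by
  have h := (lp.memℓp ψ).summable (by simp)
  exact memℓp_gen ((Equiv.mulRight a).summable_iff.mpr h)

/-- The right translation `(R_a ψ)(g) = ψ(g a)` as a bounded operator on `ℓ²(Γ)`. -/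
def rightTranslation {Γ : Type*} [Group Γ] (a : Γ) : EllTwo Γ →L[ℂ] EllTwo Γ :=
  LinearMap.mkContinuous
    { toFun := fun ψ => ⟨fun g => ψ (g * a), memlp_translate a ψ⟩
      map_add' := fun _ _ => rfl
      map_smul' := fun _ _ => rfl }
    1 (fun ψ => by
      have hp : 0 < (2 : ℝ≥0∞).toReal := by simp
      rw [one_mul, lp.norm_eq_tsum_rpow hp, lp.norm_eq_tsum_rpow hp]
      exact le_of_eq (congrArg (fun x : ℝ => x ^ (1 / (2 : ℝ≥0∞).toReal))
        ((Equiv.mulRight a).tsum_eq (fun g => ‖ψ g‖ ^ (2 : ℝ≥0∞).toReal))))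

@[simp]
theorem rightTranslation_apply {Γ : Type*} [Group Γ] (a : Γ) (ψ : EllTwo Γ) (g : Γ) :
    rightTranslation a ψ g = ψ (g * a) := rfl

/-- The Laplacian `Δ` of the free group on `d` generators `a_1, …, a_d`, a bounded operator on
`ℓ²(Γ)`: the sum over all generators and their inverses of `R_a - 1`. -/
def freeLaplacian (d : ℕ) : EllTwo (FreeGroup (Fin d)) →L[ℂ] EllTwo (FreeGroup (Fin d)) :=
  ∑ i : Fin d, ((rightTranslation (FreeGroup.of i) - 1) +
    (rightTranslation (FreeGroup.of i)⁻¹ - 1))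

/-- `(Δ ψ)(g) = ∑ [ψ(g a) - ψ(g)]`, over all generators and their inverses. -/
theorem freeLaplacian_apply (d : ℕ) (ψ : EllTwo (FreeGroup (Fin d))) (g : FreeGroup (Fin d)) :
    freeLaplacian d ψ g = ∑ i : Fin d, ((ψ (g * FreeGroup.of i) - ψ g) +
      (ψ (g * (FreeGroup.of i)⁻¹) - ψ g)) := by
  simp only [freeLaplacian, sum_apply, lp.coeFn_sum, Finset.sum_apply]
  rfl

/-- The heat kernel `p(t, g, h) = (e^{tΔ} δ_h)(g)` of the free group on `d` generators. -/
def freeHeatKernel (d : ℕ) (t : ℝ) (g h : FreeGroup (Fin d)) : ℂ :=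
  (NormedSpace.exp ((t : ℂ) • freeLaplacian d) (lp.single 2 h (1 : ℂ)) :
    EllTwo (FreeGroup (Fin d))) g

/-- The bottom `γ = 2d - 2√(2d-1)` of the spectrum. -/
def freeGap (d : ℕ) : ℝ := 2 * (d : ℝ) - 2 * Real.sqrt (2 * (d : ℝ) - 1)

end

/-!
The Laplacian of the free group is `2d - A`, where `A` is the adjacency operator of the
`(q + 1)`-regular tree, `q = 2d - 1`. In this tree every vertex other than the root has one neighbour
closer to the root and `q` neighbours further away (`sum_norm_mul_of`). Hence there are polynomials
`P_n`, given by a three-term recursion (`spherePoly`), such that `P_n(A) δ_g` is the indicator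
function of the sphere of radius `n` about `g` (`sphereVec_single_apply`). In particular
`⟨δ_g, P_n(A) δ_g⟩ = 0` for `n ≥ 1`, and as the `P_n` span all polynomials, this determines the
spectral measure at `δ_g`, the same for all `g`.

With `x = 2√q cos θ` the `P_n` are combinations of Chebyshev polynomials of the second kind, and the
probability density on `[0, π]` for which all `P_n` with `n ≥ 1` have mean zero is the Kesten–McKay
weight, proportional to `sin² θ / |q - e^{2iθ}|²`, or constant if `q = 1` (`exists_kesten_weight`).
For `q > 1` the vanishing follows from a recursion `K_{n+2} = q K_n` between bounded integrals. By Weierstrass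
approximation, `⟨δ_g, f(-Δ) δ_g⟩ = ∫ f(2d - 2√q cos θ) w(θ) dθ` for every continuous `f`
(`hasSpectralDensity_neg_freeLaplacian`), and everything follows from this formula.

* The vectors `δ_g` are total and `f(-Δ) δ_g = 0` exactly if `f` vanishes on the range of
  `2d - 2√q cos θ`, so this range is the spectrum (`spectrum_eq_image`).
* If `K` is a closed null set with thickened indicators `f_n`, then `f_n(-Δ) → 0` strongly on every
  `δ_g` by dominated convergence, hence on every `ψ` because `‖f_n(-Δ)‖ ≤ 1`. As
  `μ_ψ(K) ≤ ⟨ψ, f_n(-Δ) ψ⟩`, all spectral measures are absolutely continuous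
  (`hasPurelyACSpectrum_of_density`).
* The heat kernel is `∫ exp(-t (2d - 2√q cos θ)) w(θ) dθ`. It is continuous in `t` with value `1` at
  `t = 0`. For `d ≥ 2` both the phase and the weight vanish to second order at `θ = 0`, and Laplace's
  method gives the decay `e^{-γ t} t^{-3/2}` (`exists_tendsto_laplace`).
-/

noncomputable section

open MeasureTheory Filter Topology

/-! ### Bounded operators and total families -/

section Total

variable {E : Type*} [NormedAddCommGroup E] [InnerProductSpace ℂ E]

theorem norm_inner_apply_le {S : E →L[ℂ] E} {c : ℝ} (hS : ‖S‖ ≤ c) (v : E) :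
    ‖inner ℂ v (S v)‖ ≤ c * ‖v‖ ^ 2 :=
  calc ‖inner ℂ v (S v)‖ ≤ ‖v‖ * ‖S v‖ := norm_inner_le_norm _ _
    _ ≤ ‖v‖ * (c * ‖v‖) := by gcongr; exact S.le_of_opNorm_le hS v
    _ = c * ‖v‖ ^ 2 := by ring

/-- If the closed span of `v` is everything, an operator vanishes as soon as it kills every `v i`. -/
theorem eq_zero_of_forall_apply_eq_zero {ι : Type*} {v : ι → E}
    (hv : (Submodule.span ℂ (Set.range v)).topologicalClosure = ⊤) {S : E →L[ℂ] E}
    (hS : ∀ i, S (v i) = 0) : S = 0 :=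
  ContinuousLinearMap.ext_on (Submodule.dense_iff_topologicalClosure_eq_top.mpr hv)
    (by rintro _ ⟨i, rfl⟩; simp [hS i])

/-- Vectors that are asymptotically killed by a bounded sequence of operators form a closed
subspace. -/
theorem tendsto_zero_of_total {ι : Type*} {v : ι → E}
    (hv : (Submodule.span ℂ (Set.range v)).topologicalClosure = ⊤) {S : ℕ → E →L[ℂ] E} {C : ℝ}
    (hC : ∀ n, ‖S n‖ ≤ C) (hS : ∀ i, Tendsto (fun n => S n (v i)) atTop (𝓝 0)) (ψ : E) :
    Tendsto (fun n => S n ψ) atTop (𝓝 0) := by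
  have hspan : ∀ χ ∈ Submodule.span ℂ (Set.range v), Tendsto (fun n => S n χ) atTop (𝓝 0) := by
    intro χ hχ
    induction hχ using Submodule.span_induction with
    | mem x hx => obtain ⟨i, rfl⟩ := hx; exact hS i
    | zero => simp
    | add x y _ _ hx hy => simpa using hx.add hy
    | smul c x _ hx => simpa using hx.const_smul c
  have hC0 : 0 ≤ C := (norm_nonneg _).trans (hC 0)
  have hψ : ψ ∈ closure (Submodule.span ℂ (Set.range v) : Set E) := by
    rw [← Submodule.topologicalClosure_coe, hv]; trivial
  rw [Metric.tendsto_atTop]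
  intro ε hε
  obtain ⟨χ, hχ, hd⟩ := Metric.mem_closure_iff.mp hψ (ε / (2 * (C + 1))) (by positivity)
  obtain ⟨N, hN⟩ := Metric.tendsto_atTop.mp (hspan χ hχ) (ε / 2) (by positivity)
  refine ⟨N, fun n hn => ?_⟩
  have h1 := hN n hn
  rw [dist_zero_right] at h1 ⊢
  have h2 : ‖S n (ψ - χ)‖ ≤ C * ‖ψ - χ‖ := (S n).le_of_opNorm_le (hC n) _
  rw [dist_eq_norm, lt_div_iff₀ (by positivity)] at hd
  have h3 : S n ψ = S n χ + S n (ψ - χ) := by simp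
  rw [h3]
  have h4 := norm_add_le (S n χ) (S n (ψ - χ))
  nlinarith [norm_nonneg (ψ - χ)]

end Total

/-! ### Spectral densities -/

section SpectralDensity

variable {E : Type*} [NormedAddCommGroup E] [InnerProductSpace ℂ E] [CompleteSpace E]

/-- The vector `v` has the spectral density `w` with respect to the parametrization
`φ : [a, b] → ℝ`: the spectral measure of `T` at `v` is the image under `φ` of `w(θ) dθ`. -/
def HasSpectralDensity (T : E →L[ℂ] E) (v : E) (φ w : ℝ → ℝ) (a b : ℝ) : Prop :=
  ∀ f : ℝ → ℝ, Continuous f →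
    inner ℂ v (cfc f T v) = ((∫ θ in a..b, f (φ θ) * w θ : ℝ) : ℂ)

/-- It is enough to test a spectral density on polynomials, by Weierstrass approximation on an
interval that contains both the spectrum and the range of `φ`. -/
theorem hasSpectralDensity_of_polynomial {T : E →L[ℂ] E} (hT : IsSelfAdjoint T) {v : E}
    {φ w : ℝ → ℝ} {a b : ℝ} (hab : a ≤ b) (hφ : Continuous φ) (hw : Continuous w)
    (h : ∀ p : Polynomial ℝ,
      inner ℂ v (Polynomial.aeval T p v) = ((∫ θ in a..b, p.eval (φ θ) * w θ : ℝ) : ℂ)) :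
    HasSpectralDensity T v φ w a b := by
  intro f hf
  obtain ⟨W, hW⟩ := (isCompact_Icc (a := a) (b := b)).exists_bound_of_continuousOn hw.continuousOn
  have hW0 : 0 ≤ W := (norm_nonneg _).trans (hW a ⟨le_rfl, hab⟩)
  obtain ⟨M₁, hM₁⟩ := (isCompact_Icc (a := a) (b := b)).exists_bound_of_continuousOn hφ.continuousOn
  set M := max M₁ (‖T‖ * ‖(1 : E →L[ℂ] E)‖)
  have key : ∀ ε > 0, ‖inner ℂ v (cfc f T v) - ((∫ θ in a..b, f (φ θ) * w θ : ℝ) : ℂ)‖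
      ≤ ε * (‖v‖ ^ 2 + W * (b - a)) := by
    intro ε hε
    obtain ⟨p, hp⟩ := exists_polynomial_near_of_continuousOn (-M) M f hf.continuousOn ε hε
    have h1 : ‖cfc f T - Polynomial.aeval T p‖ ≤ ε := by
      rw [← cfc_polynomial p T, ← cfc_sub f p.eval T]
      refine norm_cfc_le hε.le fun x hx => ?_
      have hx' : |x| ≤ M := (spectrum.norm_le_norm_mul_of_mem hx).trans (le_max_right _ _)
      rw [Real.norm_eq_abs, abs_sub_comm]
      exact (hp x (abs_le.mp hx')).le
    have h2 : ‖(∫ θ in a..b, p.eval (φ θ) * w θ) - ∫ θ in a..b, f (φ θ) * w θ‖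
        ≤ ε * W * |b - a| := by
      rw [← intervalIntegral.integral_sub
        (Continuous.intervalIntegrable (by fun_prop) _ _)
        (Continuous.intervalIntegrable (by fun_prop) _ _)]
      refine intervalIntegral.norm_integral_le_of_norm_le_const fun θ hθ => ?_
      rw [Set.uIoc_of_le hab] at hθ
      have hθ' := Set.Ioc_subset_Icc_self hθ
      rw [← sub_mul, norm_mul]
      gcongr
      · exact (hp _ (abs_le.mp ((hM₁ θ hθ').trans (le_max_left _ _)))).le
      · exact hW θ hθ'
    have h3 : inner ℂ v (cfc f T v) - ((∫ θ in a..b, f (φ θ) * w θ : ℝ) : ℂ) =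
        inner ℂ v ((cfc f T - Polynomial.aeval T p) v) +
        (((∫ θ in a..b, p.eval (φ θ) * w θ) - ∫ θ in a..b, f (φ θ) * w θ : ℝ) : ℂ) := by
      rw [sub_apply, inner_sub_right, h p]
      push_cast
      ring
    rw [h3]
    refine (norm_add_le _ _).trans ?_
    rw [Complex.norm_real]
    have := norm_inner_apply_le h1 v
    rw [abs_of_nonneg (sub_nonneg.mpr hab)] at h2
    linarith
  have hC : 0 ≤ ‖v‖ ^ 2 + W * (b - a) := by have := sub_nonneg.mpr hab; positivity
  rw [← sub_eq_zero, ← norm_le_zero_iff]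
  refine le_of_forall_pos_le_add fun ε hε => ?_
  refine (key (ε / (‖v‖ ^ 2 + W * (b - a) + 1)) (by positivity)).trans ?_
  rw [zero_add, div_mul_eq_mul_div, div_le_iff₀ (by positivity)]
  nlinarith

variable {T : E →L[ℂ] E} {φ w : ℝ → ℝ} {a b : ℝ}

theorem norm_cfc_apply_sq {v : E} (h : HasSpectralDensity T v φ w a b)
    {f : ℝ → ℝ} (hf : Continuous f) :
    ‖cfc f T v‖ ^ 2 = ∫ θ in a..b, f (φ θ) ^ 2 * w θ := by
  have h1 := h (fun x => f x * f x) (hf.mul hf)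
  have hsa : IsSelfAdjoint (cfc f T) := cfc_predicate f T
  rw [cfc_mul f f T hf.continuousOn hf.continuousOn, mul_apply_eq_comp,
    ← ContinuousLinearMap.adjoint_inner_left, hsa.adjoint_eq, inner_self_eq_norm_sq_to_K] at h1
  have h2 : ((‖cfc f T v‖ ^ 2 : ℝ) : ℂ) = ((∫ θ in a..b, f (φ θ) * f (φ θ) * w θ : ℝ) : ℂ) := by
    rw [← h1]; norm_cast
  simpa only [sq] using Complex.ofReal_injective h2

/-- If a total family of vectors has the common spectral density `w > 0`, then the spectrum is the
range of the parametrization. A continuous function vanishing on one of the two closed sets but not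
at a point of the other would violate the defining identity. -/
theorem spectrum_eq_image [Nontrivial E] (hT : IsSelfAdjoint T) {ι : Type*} [Nonempty ι]
    {v : ι → E} (hv : (Submodule.span ℂ (Set.range v)).topologicalClosure = ⊤)
    (h : ∀ i, HasSpectralDensity T (v i) φ w a b) (hab : a < b) (hφ : Continuous φ)
    (hw : Continuous w) (hpos : ∀ θ ∈ Set.Ioo a b, 0 < w θ) :
    spectrum ℝ T = φ '' Set.Icc a b := by
  have hKc : IsCompact (φ '' Set.Icc a b) := isCompact_Icc.image hφ
  have hσc : IsClosed (spectrum ℝ T) := spectrum.isClosed T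
  have hσn : (spectrum ℝ T).Nonempty := ContinuousFunctionalCalculus.spectrum_nonempty T hT
  have hKn : (φ '' Set.Icc a b).Nonempty := (Set.nonempty_Icc.mpr hab.le).image φ
  refine Set.Subset.antisymm (fun x hx => ?_) (fun x hx => ?_)
  · set f : ℝ → ℝ := fun y => Metric.infDist y (φ '' Set.Icc a b) with hfdef
    have hf : Continuous f := Metric.continuous_infDist_pt _
    have hzero : cfc f T = 0 := by
      refine eq_zero_of_forall_apply_eq_zero hv fun i => ?_
      rw [← norm_eq_zero, ← sq_eq_zero_iff, norm_cfc_apply_sq (h i) hf]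
      rw [intervalIntegral.integral_congr (g := fun _ => 0), intervalIntegral.integral_zero]
      intro θ hθ
      rw [Set.uIcc_of_le hab.le] at hθ
      have : f (φ θ) = 0 := Metric.infDist_zero_of_mem ⟨θ, hθ, rfl⟩
      simp [this]
    have h1 : f x ∈ spectrum ℝ (cfc f T) := by
      rw [cfc_map_spectrum f T hT hf.continuousOn]
      exact ⟨x, hx, rfl⟩
    rw [hzero, spectrum.zero_eq] at h1
    exact (hKc.isClosed.mem_iff_infDist_zero hKn).mpr h1
  · set f : ℝ → ℝ := fun y => Metric.infDist y (spectrum ℝ T) with hfdef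
    have hf : Continuous f := Metric.continuous_infDist_pt _
    have hzero : cfc f T = 0 := by
      rw [← cfc_zero ℝ T]
      exact cfc_congr fun y hy => Metric.infDist_zero_of_mem hy
    obtain ⟨i⟩ := ‹Nonempty ι›
    have hint : ∫ θ in a..b, f (φ θ) ^ 2 * w θ = 0 := by
      rw [← norm_cfc_apply_sq (h i) hf, hzero]; simp
    have hw0 : ∀ θ ∈ Set.Icc a b, 0 ≤ w θ := by
      rw [← closure_Ioo hab.ne]
      intro θ hθ
      exact closure_minimal (fun y hy => (hpos y hy).le) (isClosed_le continuous_const hw) hθ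
    have hvan : ∀ θ ∈ Set.Ioo a b, f (φ θ) = 0 := by
      intro θ hθ
      by_contra hne
      refine absurd hint (ne_of_gt (intervalIntegral.integral_pos hab ?_ ?_ ?_))
      · exact Continuous.continuousOn (by fun_prop)
      · intro y hy
        have := hw0 y (Set.Ioc_subset_Icc_self hy)
        positivity
      · exact ⟨θ, Set.Ioo_subset_Icc_self hθ, mul_pos (by positivity) (hpos θ hθ)⟩
    obtain ⟨θ, hθ, rfl⟩ := hx
    rw [hσc.mem_iff_infDist_zero hσn]
    rw [← closure_Ioo hab.ne] at hθ
    exact closure_minimal hvan (isClosed_eq (hf.comp hφ) continuous_const) hθ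

/-- Every vector has a spectral measure: the Riesz measure of `f ↦ ⟨ψ, f(T) ψ⟩` on the compact
spectrum, pushed forward to `ℝ`. -/
theorem exists_isSpectralMeasure (hT : IsSelfAdjoint T) (ψ : E) :
    ∃ μ : Measure ℝ, IsSpectralMeasure T ψ μ := by
  have : CompactSpace (spectrum ℝ T) :=
    isCompact_iff_compactSpace.mp (ContinuousFunctionalCalculus.isCompact_spectrum T)
  let Λ₀ : CompactlySupportedContinuousMap (spectrum ℝ T) ℝ →ₗ[ℝ] ℝ :=
    { toFun := fun f => (inner ℂ ψ (cfcHom hT (f : C(spectrum ℝ T, ℝ)) ψ)).re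
      map_add' := fun f g => by
        have : ((f + g : CompactlySupportedContinuousMap (spectrum ℝ T) ℝ) :
          C(spectrum ℝ T, ℝ)) = (f : C(spectrum ℝ T, ℝ)) + (g : C(spectrum ℝ T, ℝ)) := rfl
        rw [this, map_add, add_apply, inner_add_right, Complex.add_re]
      map_smul' := fun c f => by
        have : ((c • f : CompactlySupportedContinuousMap (spectrum ℝ T) ℝ) :
          C(spectrum ℝ T, ℝ)) = c • (f : C(spectrum ℝ T, ℝ)) := rfl
        rw [this, map_smul, smul_apply, RingHom.id_apply, ← Complex.coe_smul, inner_smul_right]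
        simp }
  let Λ : CompactlySupportedContinuousMap (spectrum ℝ T) ℝ →ₚ[ℝ] ℝ :=
    PositiveLinearMap.mk₀ Λ₀ fun f hf => by
      have h1 : (0 : E →L[ℂ] E) ≤ cfcHom hT (f : C(spectrum ℝ T, ℝ)) :=
        (cfcHom_nonneg_iff hT).mpr fun x => hf x
      exact ((ContinuousLinearMap.nonneg_iff_isPositive _).mp h1).re_inner_nonneg_right ψ
  let ν := RealRMK.rieszMeasure Λ
  have hνfin : IsFiniteMeasure ν := ⟨isCompact_univ.measure_lt_top⟩
  refine ⟨ν.map (fun x : spectrum ℝ T => (x : ℝ)), inferInstance, fun f => ?_⟩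
  rw [integral_map (by fun_prop) f.continuous.aestronglyMeasurable]
  let g : CompactlySupportedContinuousMap (spectrum ℝ T) ℝ :=
    CompactlySupportedContinuousMap.continuousMapEquiv ⟨fun x => f x, by fun_prop⟩
  have h1 : ∫ x, f (x : ℝ) ∂ν = (inner ℂ ψ (cfcHom hT (g : C(spectrum ℝ T, ℝ)) ψ)).re :=
    RealRMK.integral_rieszMeasure Λ g
  have hsa : IsSelfAdjoint (cfc (fun x : ℝ => f x) T) := cfc_predicate _ T
  have h2 : cfc (fun x : ℝ => f x) T = cfcHom hT (g : C(spectrum ℝ T, ℝ)) :=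
    cfc_apply (fun x : ℝ => f x) T hT f.continuous.continuousOn
  rw [h1, ← h2]
  refine (Complex.conj_eq_iff_re.mp ?_).symm
  rw [inner_conj_symm, ← ContinuousLinearMap.adjoint_inner_right, hsa.adjoint_eq]

/-- A vector with a spectral density is asymptotically killed by the thickened indicators of a
closed set whose preimage under the parametrization is a null set. -/
theorem tendsto_cfc_thickenedIndicator {v : E} (h : HasSpectralDensity T v φ w a b) (hab : a ≤ b)
    (hφ : Continuous φ) (hw : Continuous w) {K : Set ℝ} (hK : IsClosed K)
    (hnull : volume (Set.Ioc a b ∩ φ ⁻¹' K) = 0) {δ : ℕ → ℝ} (hδ : ∀ n, 0 < δ n)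
    (hlim : Tendsto δ atTop (𝓝 0)) :
    Tendsto (fun n => cfc (fun x => (thickenedIndicator (hδ n) K x : ℝ)) T v) atTop (𝓝 0) := by
  have hcont : ∀ n, Continuous fun x => (thickenedIndicator (hδ n) K x : ℝ) := fun n =>
    NNReal.continuous_coe.comp (thickenedIndicator (hδ n) K).continuous
  have hcw := fun n => (((hcont n).comp hφ).pow 2).mul hw
  have hpt := tendsto_pi_nhds.mp (thickenedIndicator_tendsto_indicator_closure hδ hlim K)
  rw [hK.closure_eq] at hpt
  have hsq : Tendsto (fun n => ‖cfc (fun x => (thickenedIndicator (hδ n) K x : ℝ)) T v‖ ^ 2)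
      atTop (𝓝 0) := by
    simp_rw [norm_cfc_apply_sq h (hcont _)]
    rw [← intervalIntegral.integral_zero (a := a) (b := b) (μ := volume)]
    refine intervalIntegral.tendsto_integral_filter_of_dominated_convergence (fun θ => ‖w θ‖)
      (.of_forall fun n => (hcw n).aestronglyMeasurable) (.of_forall fun n => .of_forall
        fun θ _ => ?_) (hw.norm.intervalIntegrable _ _) ?_
    · rw [norm_mul]
      have h1 : (thickenedIndicator (hδ n) K (φ θ) : ℝ) ≤ 1 :=
        NNReal.coe_le_one.mpr (thickenedIndicator_le_one (hδ n) K (φ θ))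
      have h0 : 0 ≤ (thickenedIndicator (hδ n) K (φ θ) : ℝ) := NNReal.coe_nonneg _
      refine mul_le_of_le_one_left (norm_nonneg _) ?_
      rw [Real.norm_eq_abs, abs_of_nonneg (by positivity)]
      exact pow_le_one₀ h0 h1
    · rw [measure_eq_zero_iff_ae_notMem] at hnull
      filter_upwards [hnull] with θ hθ hmem
      rw [Set.uIoc_of_le hab] at hmem
      have hnot : φ θ ∉ K := fun hk => hθ ⟨hmem, hk⟩
      have := hpt (φ θ)
      rw [Set.indicator_of_notMem hnot] at this
      have h2 := (((NNReal.continuous_coe.tendsto 0).comp this).pow 2).mul_const (w θ)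
      simpa using h2
  rw [tendsto_zero_iff_norm_tendsto_zero]
  have := hsq.sqrt
  simpa using this

/-- If a total family of vectors has a common spectral density and preimages of null sets under the
parametrization are null sets, then the spectrum is purely absolutely continuous. For a closed null
set `K` and a vector `ψ`, the spectral measure satisfies `μ_ψ(K) ≤ ⟨ψ, f_n(T) ψ⟩`, where `f_n` are
the thickened indicators of `K`, and `f_n(T) → 0` strongly. -/
theorem hasPurelyACSpectrum_of_density (hT : IsSelfAdjoint T) {ι : Type*} {v : ι → E}
    (hv : (Submodule.span ℂ (Set.range v)).topologicalClosure = ⊤)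
    (h : ∀ i, HasSpectralDensity T (v i) φ w a b) (hab : a ≤ b) (hφ : Continuous φ)
    (hw : Continuous w)
    (hnull : ∀ K : Set ℝ, volume K = 0 → volume (Set.Ioc a b ∩ φ ⁻¹' K) = 0) :
    HasPurelyACSpectrum T := by
  refine ⟨hT, fun ψ => ?_⟩
  obtain ⟨μ, hμ⟩ := exists_isSpectralMeasure hT ψ
  have hfin := hμ.isFiniteMeasure
  refine ⟨μ, hμ, ?_⟩
  have hclosed : ∀ K : Set ℝ, IsClosed K → volume K = 0 → μ K = 0 := by
    intro K hK hK0
    have hδ : ∀ n : ℕ, (0 : ℝ) < 1 / (n + 1) := fun n => by positivity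
    let F : ℕ → (ℝ →ᵇ ℝ) := fun n =>
      BoundedContinuousFunction.mkOfBound
        ⟨fun x => (thickenedIndicator (hδ n) K x : ℝ),
          NNReal.continuous_coe.comp (thickenedIndicator (hδ n) K).continuous⟩ 1
        (fun x y => by
          have hx : (thickenedIndicator (hδ n) K x : ℝ) ≤ 1 :=
            NNReal.coe_le_one.mpr (thickenedIndicator_le_one (hδ n) K x)
          have hy : (thickenedIndicator (hδ n) K y : ℝ) ≤ 1 :=
            NNReal.coe_le_one.mpr (thickenedIndicator_le_one (hδ n) K y)
          have hx0 : 0 ≤ (thickenedIndicator (hδ n) K x : ℝ) := NNReal.coe_nonneg _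
          have hy0 : 0 ≤ (thickenedIndicator (hδ n) K y : ℝ) := NNReal.coe_nonneg _
          change |(thickenedIndicator (hδ n) K x : ℝ) - (thickenedIndicator (hδ n) K y : ℝ)| ≤ 1
          rw [abs_le]; constructor <;> linarith)
    have hF : ∀ n x, F n x = (thickenedIndicator (hδ n) K x : ℝ) := fun _ _ => rfl
    have hst : Tendsto (fun n => cfc (fun x => F n x) T ψ) atTop (𝓝 0) := by
      refine tendsto_zero_of_total hv (C := 1) (fun n => norm_cfc_le zero_le_one fun x _ => ?_)
        (fun i => tendsto_cfc_thickenedIndicator (h i) hab hφ hw hK (hnull K hK0) hδ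
          tendsto_one_div_add_atTop_nhds_zero_nat) ψ
      rw [Real.norm_eq_abs, abs_of_nonneg (NNReal.coe_nonneg _)]
      exact NNReal.coe_le_one.mpr (thickenedIndicator_le_one (hδ n) K x)
    have hle : ∀ n, μ.real K ≤ ‖inner ℂ ψ (cfc (fun x => F n x) T ψ)‖ := by
      intro n
      rw [hμ.integral_eq, Complex.norm_real, ← integral_indicator_one hK.measurableSet]
      refine (integral_mono ?_ ((F n).integrable μ) fun x => ?_).trans (le_abs_self _)
      · exact (integrable_const (1 : ℝ)).indicator hK.measurableSet
      · by_cases hx : x ∈ K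
        · rw [Set.indicator_of_mem hx, hF, thickenedIndicator_one (hδ n) K hx]; simp
        · rw [Set.indicator_of_notMem hx, hF]; exact NNReal.coe_nonneg _
    have hlim : Tendsto (fun n => ‖inner ℂ ψ (cfc (fun x => F n x) T ψ)‖) atTop (𝓝 0) := by
      simpa using ((tendsto_const_nhds (x := ψ)).inner (𝕜 := ℂ) hst).norm
    have h0 : μ.real K ≤ 0 := ge_of_tendsto' hlim hle
    rw [← measureReal_eq_zero_iff]
    exact le_antisymm h0 measureReal_nonneg
  refine Measure.AbsolutelyContinuous.mk fun s hs hs0 => ?_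
  rw [hs.measure_eq_iSup_isClosed_of_ne_top (measure_ne_top μ s)]
  simp only [ENNReal.iSup_eq_zero]
  exact fun K hKs hK => hclosed K hK (measure_mono_null hKs hs0)

end SpectralDensity

/-! ### Spheres in the free group -/

theorem norm_mk_singleton_mul {α : Type*} [DecidableEq α] (s y : α × Bool) (t : List (α × Bool))
    {x : FreeGroup α} (hx : x.toWord = y :: t) :
    (FreeGroup.mk [s] * x).norm =
      if s = (y.1, !y.2) then x.norm - 1 else x.norm + 1 := by
  have h1 : (FreeGroup.mk [s] * x).toWord = FreeGroup.reduce (s :: x.toWord) := by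
    conv_lhs => rw [← FreeGroup.mk_toWord (x := x), FreeGroup.mul_mk, FreeGroup.toWord_mk]
    rfl
  rw [FreeGroup.norm, h1, FreeGroup.reduce.cons, FreeGroup.reduce_toWord, FreeGroup.norm, hx]
  by_cases hs : s = (y.1, !y.2)
  · simp [hs]
  · have : ¬ (s.1 = y.1 ∧ s.2 = !y.2) := fun h => hs (Prod.ext h.1 h.2)
    simp [hs, this]

/-- In the Cayley tree, a vertex other than the root has one neighbour closer to the root and
`2d - 1` neighbours further away. -/
theorem sum_norm_mul_of {d : ℕ} (f : ℕ → ℂ) {x : FreeGroup (Fin d)} (hx : x ≠ 1) :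
    ∑ i : Fin d, (f (x * FreeGroup.of i).norm + f (x * (FreeGroup.of i)⁻¹).norm) =
      f (x.norm - 1) + (2 * d - 1) * f (x.norm + 1) := by
  have hw : x⁻¹.toWord ≠ [] := by
    rwa [Ne, FreeGroup.toWord_eq_nil_iff, inv_eq_one]
  obtain ⟨y, t, hyt⟩ := List.exists_cons_of_ne_nil hw
  have hterm : ∀ s : Fin d × Bool, f (FreeGroup.mk [s] * x⁻¹).norm =
      f (x.norm + 1) + if s = (y.1, !y.2) then f (x.norm - 1) - f (x.norm + 1) else 0 := by
    intro s
    rw [norm_mk_singleton_mul s y t hyt, FreeGroup.norm_inv_eq]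
    split_ifs <;> simp
  have hsum : ∑ i : Fin d, (f (x * FreeGroup.of i).norm + f (x * (FreeGroup.of i)⁻¹).norm) =
      ∑ s : Fin d × Bool, f (FreeGroup.mk [s] * x⁻¹).norm := by
    rw [Fintype.sum_prod_type]
    refine Finset.sum_congr rfl fun i _ => ?_
    rw [Fintype.sum_bool, add_comm]
    congr 2
    · rw [← FreeGroup.norm_inv_eq, mul_inv_rev, inv_inv]; rfl
    · rw [← FreeGroup.norm_inv_eq, mul_inv_rev]; rfl
  rw [hsum, Finset.sum_congr rfl fun s _ => hterm s, Finset.sum_add_distrib,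
    Finset.sum_ite_eq' Finset.univ (y.1, !y.2)]
  simp only [Finset.sum_const, Finset.card_univ, Fintype.card_prod, Fintype.card_fin,
    Fintype.card_bool, nsmul_eq_mul, Finset.mem_univ, if_true]
  push_cast
  ring

/-! ### The adjacency operator and its polynomials -/

/-- The adjacency operator `∑ R_a` of the Cayley tree, over all generators and their inverses. -/
def freeAdjacency (d : ℕ) : EllTwo (FreeGroup (Fin d)) →L[ℂ] EllTwo (FreeGroup (Fin d)) :=
  ∑ i : Fin d, (rightTranslation (FreeGroup.of i) + rightTranslation (FreeGroup.of i)⁻¹)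

theorem freeAdjacency_apply (d : ℕ) (ψ : EllTwo (FreeGroup (Fin d))) (g : FreeGroup (Fin d)) :
    freeAdjacency d ψ g =
      ∑ i : Fin d, (ψ (g * FreeGroup.of i) + ψ (g * (FreeGroup.of i)⁻¹)) := by
  simp only [freeAdjacency, sum_apply, lp.coeFn_sum, Finset.sum_apply]
  rfl

theorem neg_freeLaplacian_eq (d : ℕ) :
    -freeLaplacian d = (((2 * d : ℝ)) : ℂ) • 1 - freeAdjacency d := by
  ext ψ g
  rw [neg_apply, lp.coeFn_neg, Pi.neg_apply, freeLaplacian_apply, sub_apply, lp.coeFn_sub,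
    Pi.sub_apply, smul_apply, lp.coeFn_smul, Pi.smul_apply, one_apply_eq_self, smul_eq_mul,
    freeAdjacency_apply]
  simp only [Finset.sum_add_distrib, Finset.sum_sub_distrib, Finset.sum_const, Finset.card_univ,
    Fintype.card_fin, nsmul_eq_mul]
  push_cast
  ring

theorem adjoint_rightTranslation {Γ : Type*} [Group Γ] (a : Γ) :
    ContinuousLinearMap.adjoint (rightTranslation a) = rightTranslation a⁻¹ := by
  symm
  rw [ContinuousLinearMap.eq_adjoint_iff]
  intro ψ χ
  rw [lp.inner_eq_tsum, lp.inner_eq_tsum, ← (Equiv.mulRight a).tsum_eq]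
  simp

theorem isSelfAdjoint_freeAdjacency (d : ℕ) : IsSelfAdjoint (freeAdjacency d) := by
  rw [freeAdjacency]
  refine isSelfAdjoint_sum _ fun i _ => ?_
  rw [IsSelfAdjoint, star_add, ContinuousLinearMap.star_eq_adjoint,
    ContinuousLinearMap.star_eq_adjoint, adjoint_rightTranslation, adjoint_rightTranslation,
    inv_inv, add_comm]

/-- The polynomials `P_n` for which `P_n(A) δ_g` is the indicator function of the sphere of radius
`n` about `g`, where `A` is the adjacency operator of the `(q + 1)`-regular tree. -/
def spherePoly (q : ℝ) : ℕ → Polynomial ℝ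
  | 0 => 1
  | 1 => Polynomial.X
  | 2 => Polynomial.X * Polynomial.X - Polynomial.C (q + 1)
  | n + 3 => Polynomial.X * spherePoly q (n + 2) - Polynomial.C q * spherePoly q (n + 1)

/-- The vectors `P_n(A) v`, defined by the recursion of the sphere polynomials. -/
def sphereVec {E : Type*} [NormedAddCommGroup E] [InnerProductSpace ℂ E] (A : E →L[ℂ] E) (q : ℝ)
    (v : E) : ℕ → E
  | 0 => v
  | 1 => A v
  | 2 => A (A v) - ((q + 1 : ℝ) : ℂ) • v
  | n + 3 => A (sphereVec A q v (n + 2)) - (q : ℂ) • sphereVec A q v (n + 1)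

theorem aeval_spherePoly_apply {E : Type*} [NormedAddCommGroup E] [InnerProductSpace ℂ E]
    (A : E →L[ℂ] E) (q : ℝ) (v : E) (n : ℕ) :
    Polynomial.aeval A (spherePoly q n) v = sphereVec A q v n := by
  have hC : ∀ (c : ℝ) (x : E), (algebraMap ℝ (E →L[ℂ] E) c) x = (c : ℂ) • x := fun c x => by
    rw [Algebra.algebraMap_eq_smul_one, Complex.coe_smul]; rfl
  induction n using Nat.strong_induction_on with
  | _ n ih =>
    match n, ih with
    | 0, _ => simp [spherePoly, sphereVec]
    | 1, _ => simp [spherePoly, sphereVec]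
    | 2, _ =>
      rw [spherePoly, map_sub, map_mul, Polynomial.aeval_X, Polynomial.aeval_C, sub_apply,
        mul_apply_eq_comp, hC, sphereVec]
    | n + 3, ih =>
      rw [spherePoly, map_sub, map_mul, map_mul, Polynomial.aeval_X, Polynomial.aeval_C,
        sub_apply, mul_apply_eq_comp, mul_apply_eq_comp, hC, ih (n + 2) (by omega),
        ih (n + 1) (by omega), sphereVec]

/-- `P_n(A) δ_g` is the indicator function of the sphere of radius `n` about `g`. -/
theorem sphereVec_single_apply (d n : ℕ) (g h : FreeGroup (Fin d)) :
    sphereVec (freeAdjacency d) (2 * d - 1) (lp.single 2 g (1 : ℂ)) n h =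
      if (g⁻¹ * h).norm = n then 1 else 0 := by
  have h0 : ∀ h, (lp.single 2 g (1 : ℂ) : EllTwo (FreeGroup (Fin d))) h =
      if (g⁻¹ * h).norm = 0 then 1 else 0 := by
    intro h
    rw [lp.single_apply, Pi.single_apply]
    simp only [FreeGroup.norm_eq_zero, inv_mul_eq_one, eq_comm]
  -- One application of the adjacency operator to a function of the distance to `g`.
  have hA : ∀ (ψ : EllTwo (FreeGroup (Fin d))) (f : ℕ → ℂ),
      (∀ h, ψ h = f (g⁻¹ * h).norm) → ∀ h, freeAdjacency d ψ h =
        if (g⁻¹ * h).norm = 0 then 2 * d * f 1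
        else f ((g⁻¹ * h).norm - 1) + (2 * d - 1) * f ((g⁻¹ * h).norm + 1) := by
    intro ψ f hψ h
    rw [freeAdjacency_apply]
    simp only [hψ, ← mul_assoc]
    split_ifs with hn
    · rw [FreeGroup.norm_eq_zero] at hn
      simp only [hn, one_mul, FreeGroup.norm_inv_eq, FreeGroup.norm_of, Finset.sum_const,
        Finset.card_univ, Fintype.card_fin, nsmul_eq_mul]
      ring
    · exact sum_norm_mul_of f (by simpa using hn)
  induction n using Nat.strong_induction_on generalizing h with
  | _ n ih =>
    match n, ih with
    | 0, _ => exact h0 h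
    | 1, _ =>
      rw [sphereVec]
      rw [hA _ (fun k => if k = 0 then 1 else 0) h0]
      generalize (g⁻¹ * h).norm = m
      rcases m with _ | _ | m <;> simp
    | 2, ih =>
      have h1 := hA _ (fun k => if k = 1 then 1 else 0) (fun h => ih 1 (by norm_num) h) h
      rw [sphereVec] at h1
      rw [sphereVec, lp.coeFn_sub, Pi.sub_apply, lp.coeFn_smul, Pi.smul_apply, smul_eq_mul, h1, h0]
      push_cast
      generalize (g⁻¹ * h).norm = m
      rcases m with _ | _ | _ | m <;> simp
    | n + 3, ih =>
      have h1 := hA _ (fun k => if k = n + 2 then 1 else 0) (fun h => ih (n + 2) (by omega) h) h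
      rw [sphereVec, lp.coeFn_sub, Pi.sub_apply, lp.coeFn_smul, Pi.smul_apply, smul_eq_mul, h1,
        ih (n + 1) (by omega)]
      push_cast
      generalize (g⁻¹ * h).norm = m
      rcases m with _ | m
      · simp
      · by_cases hm : m = n + 2
        · subst hm; simp
        · by_cases hm' : m = n
          · subst hm'; simp
          · simp [hm, hm']

theorem span_spherePoly (q : ℝ) : Submodule.span ℝ (Set.range (spherePoly q)) = ⊤ := by
  set S := Submodule.span ℝ (Set.range (spherePoly q))
  have hmem : ∀ n, spherePoly q n ∈ S := fun n => Submodule.subset_span ⟨n, rfl⟩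
  have hC : ∀ (c : ℝ) {p : Polynomial ℝ}, p ∈ S → Polynomial.C c * p ∈ S := fun c p hp => by
    rw [← Polynomial.smul_eq_C_mul]; exact S.smul_mem c hp
  have hX : ∀ p ∈ S, Polynomial.X * p ∈ S := by
    intro p hp
    induction hp using Submodule.span_induction with
    | mem x hx =>
      obtain ⟨n, rfl⟩ := hx
      match n with
      | 0 => simpa [spherePoly] using hmem 1
      | 1 =>
        have h := S.add_mem (hmem 2) (hC (q + 1) (hmem 0))
        convert h using 1
        simp only [spherePoly]; ring
      | n + 2 =>
        have h := S.add_mem (hmem (n + 3)) (hC q (hmem (n + 1)))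
        convert h using 1
        simp only [spherePoly]; ring
    | zero => simp
    | add x y _ _ hx hy => rw [mul_add]; exact S.add_mem hx hy
    | smul c x _ hx => rw [mul_smul_comm]; exact S.smul_mem c hx
  rw [eq_top_iff]
  intro p _
  induction p using Polynomial.induction_on' with
  | add p q hp hq => exact S.add_mem (hp trivial) (hq trivial)
  | monomial n a =>
    rw [← Polynomial.C_mul_X_pow_eq_monomial]
    refine hC a ?_
    clear * - hX hmem
    induction n with
    | zero => exact hmem 0
    | succ n ih => rw [pow_succ']; exact hX _ ih

theorem span_single_dense (Γ : Type*) [DecidableEq Γ] :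
    (Submodule.span ℂ (Set.range fun g : Γ =>
      (lp.single 2 g (1 : ℂ) : EllTwo Γ))).topologicalClosure = ⊤ := by
  rw [eq_top_iff]
  intro ψ _
  have h := lp.hasSum_single (p := 2) (by simp) ψ
  rw [← SetLike.mem_coe, Submodule.topologicalClosure_coe]
  refine mem_closure_of_tendsto h (.of_forall fun s => Submodule.sum_mem _ fun g _ => ?_)
  have : (lp.single 2 g (ψ g) : EllTwo Γ) = ψ g • lp.single 2 g (1 : ℂ) := by
    rw [← lp.single_smul, smul_eq_mul, mul_one]
  rw [this]
  exact Submodule.smul_mem _ _ (Submodule.subset_span ⟨g, rfl⟩)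

/-! ### The Kesten–McKay weight -/

theorem integral_cos_nat_mul (n : ℕ) : ∫ θ in (0 : ℝ)..Real.pi, Real.cos ((n + 1) * θ) = 0 := by
  have hn : (n : ℝ) + 1 ≠ 0 := by positivity
  rw [intervalIntegral.integral_comp_mul_left (fun x => Real.cos x) hn, integral_cos]
  have := Real.sin_nat_mul_pi (n + 1)
  push_cast at this
  simp [this]

theorem integral_sin_mul_sin (n : ℕ) :
    ∫ θ in (0 : ℝ)..Real.pi, Real.sin θ * Real.sin ((n + 2) * θ) = 0 := by
  have h : ∀ θ : ℝ, Real.sin θ * Real.sin ((n + 2) * θ) =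
      1 / 2 * Real.cos ((n + 1) * θ) - 1 / 2 * Real.cos (((n + 2 : ℕ) + 1) * θ) := by
    intro θ
    have h1 : ((n : ℝ) + 1) * θ = (n + 2) * θ - θ := by ring
    have h2 : (((n + 2 : ℕ) : ℝ) + 1) * θ = (n + 2) * θ + θ := by push_cast; ring
    rw [h1, h2, Real.cos_sub, Real.cos_add]
    ring
  simp_rw [h]
  rw [intervalIntegral.integral_sub (Continuous.intervalIntegrable (by fun_prop) _ _)
    (Continuous.intervalIntegrable (by fun_prop) _ _), intervalIntegral.integral_const_mul,
    intervalIntegral.integral_const_mul, integral_cos_nat_mul, integral_cos_nat_mul]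
  simp

theorem spherePoly_one_eval (n : ℕ) (θ : ℝ) :
    (spherePoly 1 (n + 1)).eval (2 * Real.cos θ) = 2 * Real.cos ((n + 1) * θ) := by
  induction n using Nat.strong_induction_on with
  | _ n ih =>
    match n, ih with
    | 0, _ => simp [spherePoly]
    | 1, _ =>
      have h : ((1 : ℕ) + 1 : ℝ) * θ = 2 * θ := by norm_num
      rw [h, Real.cos_two_mul]
      simp [spherePoly]
      ring
    | n + 2, ih =>
      have e0 := ih n (by omega)
      have e1 := ih (n + 1) (by omega)
      have h0 : ((n : ℝ) + 1) * θ = (((n + 1 : ℕ) : ℝ) + 1) * θ - θ := by push_cast; ring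
      have h2 : (((n + 2 : ℕ) : ℝ) + 1) * θ = (((n + 1 : ℕ) : ℝ) + 1) * θ + θ := by push_cast; ring
      rw [h0, Real.cos_sub] at e0
      rw [h2, Real.cos_add]
      simp only [spherePoly, Polynomial.eval_sub, Polynomial.eval_mul, Polynomial.eval_X,
        Polynomial.eval_C, e0, e1]
      ring

/-- On the spectrum `x = 2√q cos θ`, the sphere polynomials are Chebyshev polynomials of the second
kind: `P_{n+1} = q^{(n+1)/2} (U_{n+1} - q⁻¹ U_{n-1})(cos θ)`. -/
theorem spherePoly_eval_mul_sin (s : ℝ) (n : ℕ) (θ : ℝ) :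
    s * Real.sin θ * (spherePoly (s ^ 2) (n + 1)).eval (2 * s * Real.cos θ) =
      s ^ n * (s ^ 2 * Real.sin ((n + 2) * θ) - Real.sin (n * θ)) := by
  induction n using Nat.strong_induction_on with
  | _ n ih =>
    match n, ih with
    | 0, _ => simp [spherePoly, Real.sin_two_mul]; ring
    | 1, _ =>
      have h : ((1 : ℕ) + 2 : ℝ) * θ = 3 * θ := by norm_num
      rw [h, Real.sin_three_mul]
      simp only [spherePoly, Polynomial.eval_sub, Polynomial.eval_mul, Polynomial.eval_X,
        Polynomial.eval_C, Nat.cast_one, one_mul]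
      have := Real.sin_sq_add_cos_sq θ
      linear_combination (4 * s ^ 3 * Real.sin θ) * this
    | n + 2, ih =>
      have e0 := ih n (by omega)
      have e1 := ih (n + 1) (by omega)
      have a0 : (n : ℝ) * θ = (((n + 1 : ℕ) : ℝ)) * θ - θ := by push_cast; ring
      have a2 : ((n + 2 : ℕ) : ℝ) * θ = (((n + 1 : ℕ) : ℝ)) * θ + θ := by push_cast; ring
      have b0 : ((n : ℝ) + 2) * θ = (((n + 1 : ℕ) : ℝ) + 2) * θ - θ := by push_cast; ring
      have b2 : (((n + 2 : ℕ) : ℝ) + 2) * θ = (((n + 1 : ℕ) : ℝ) + 2) * θ + θ := by push_cast; ring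
      rw [b0, a0, Real.sin_sub, Real.sin_sub] at e0
      rw [b2, a2, Real.sin_add, Real.sin_add]
      simp only [spherePoly, Polynomial.eval_sub, Polynomial.eval_mul, Polynomial.eval_X,
        Polynomial.eval_C]
      linear_combination (2 * s * Real.cos θ) * e1 - s ^ 2 * e0

/-- The denominator `|q - e^{2iθ}|²` of the Kesten–McKay density. -/
def kestenDenom (q θ : ℝ) : ℝ := q ^ 2 + 1 - 2 * q * Real.cos (2 * θ)

theorem sq_le_kestenDenom {q : ℝ} (hq : 0 ≤ q) (θ : ℝ) : (q - 1) ^ 2 ≤ kestenDenom q θ := by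
  have := Real.cos_le_one (2 * θ)
  unfold kestenDenom
  nlinarith

theorem kestenDenom_pos {q : ℝ} (hq : 1 < q) (θ : ℝ) : 0 < kestenDenom q θ :=
  (pow_pos (sub_pos.mpr hq) 2).trans_le (sq_le_kestenDenom (by linarith) θ)

@[fun_prop]
theorem continuous_kestenDenom (q : ℝ) : Continuous (kestenDenom q) := by
  unfold kestenDenom; fun_prop

/-- The integrals `K_n` below satisfy `K_{n+2} = q K_n` and are bounded, so they vanish. -/
theorem integral_kesten_eq_zero {q : ℝ} (hq : 1 < q) (n : ℕ) :
    ∫ θ in (0 : ℝ)..Real.pi, Real.sin θ * (q * Real.sin ((n + 2) * θ) - Real.sin (n * θ)) /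
      kestenDenom q θ = 0 := by
  set K : ℕ → ℝ := fun n => ∫ θ in (0 : ℝ)..Real.pi,
    Real.sin θ * (q * Real.sin ((n + 2) * θ) - Real.sin (n * θ)) / kestenDenom q θ with hK
  have hne : ∀ θ, kestenDenom q θ ≠ 0 := fun θ => (kestenDenom_pos hq θ).ne'
  have hrec : ∀ n, K (n + 2) = q * K n := by
    intro n
    have h : ∀ θ : ℝ, Real.sin θ * (q * Real.sin (((n + 2 : ℕ) + 2) * θ) -
          Real.sin ((n + 2 : ℕ) * θ)) / kestenDenom q θ =
        q * (Real.sin θ * (q * Real.sin ((n + 2) * θ) - Real.sin (n * θ)) / kestenDenom q θ) -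
          Real.sin θ * Real.sin ((n + 2) * θ) := by
      intro θ
      have h4 : (((n + 2 : ℕ) : ℝ) + 2) * θ = (n + 2) * θ + 2 * θ := by push_cast; ring
      have h0 : (n : ℝ) * θ = (n + 2) * θ - 2 * θ := by ring
      have h2 : ((n + 2 : ℕ) : ℝ) = (n : ℝ) + 2 := by push_cast; rfl
      rw [h4, h0, h2, Real.sin_add, Real.sin_sub]
      have := hne θ
      field_simp
      unfold kestenDenom
      ring
    simp only [hK, h]
    rw [intervalIntegral.integral_sub _ (Continuous.intervalIntegrable (by fun_prop) _ _),
      integral_sin_mul_sin, intervalIntegral.integral_const_mul, sub_zero]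
    exact Continuous.intervalIntegrable (by fun_prop (disch := exact hne _)) _ _
  have hbound : ∀ n, |K n| ≤ (q + 1) / (q - 1) ^ 2 * |Real.pi - 0| := by
    intro n
    rw [← Real.norm_eq_abs (K n)]
    refine intervalIntegral.norm_integral_le_of_norm_le_const fun θ _ => ?_
    rw [norm_div, Real.norm_eq_abs, Real.norm_eq_abs, abs_of_pos (kestenDenom_pos hq θ)]
    have hq1 : 0 < (q - 1) ^ 2 := pow_pos (sub_pos.mpr hq) 2
    refine div_le_div₀ (by linarith) ?_ hq1 (sq_le_kestenDenom (by linarith) θ)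
    rw [abs_mul]
    have h1 := Real.abs_sin_le_one θ
    have h2 : |q * Real.sin ((n + 2) * θ) - Real.sin (n * θ)| ≤ q + 1 := by
      refine (abs_sub _ _).trans ?_
      rw [abs_mul, abs_of_pos (by linarith : 0 < q)]
      have := Real.abs_sin_le_one ((n + 2) * θ)
      have := Real.abs_sin_le_one (n * θ)
      nlinarith
    exact (mul_le_of_le_one_left (abs_nonneg _) h1).trans h2
  have hpow : ∀ k, K (n + 2 * k) = q ^ k * K n := by
    intro k
    induction k with
    | zero => simp
    | succ k ih => rw [show n + 2 * (k + 1) = n + 2 * k + 2 by ring, hrec, ih]; ring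
  by_contra hne0
  have hpos : 0 < |K n| := abs_pos.mpr hne0
  obtain ⟨k, hk⟩ := pow_unbounded_of_one_lt ((q + 1) / (q - 1) ^ 2 * |Real.pi - 0| / |K n|) hq
  rw [div_lt_iff₀ hpos] at hk
  have h1 := hbound (n + 2 * k)
  rw [hpow, abs_mul, abs_of_pos (pow_pos (by linarith) k)] at h1
  linarith

/-- The Kesten–McKay weight: the probability density on `[0, π]` for which the sphere polynomials of
positive degree have mean zero, in the parametrization `x = 2√q cos θ`. The case `q = 1` is the
arcsine law. -/
theorem exists_kesten_weight {q : ℝ} (hq : 1 ≤ q) :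
    ∃ w : ℝ → ℝ, Continuous w ∧ (∀ θ ∈ Set.Ioo 0 Real.pi, 0 < w θ) ∧
      (∫ θ in (0 : ℝ)..Real.pi, w θ) = 1 ∧
      (∀ n, ∫ θ in (0 : ℝ)..Real.pi,
        (spherePoly q (n + 1)).eval (2 * Real.sqrt q * Real.cos θ) * w θ = 0) ∧
      (1 < q → ∃ C > 0, ∀ θ, w θ = C * (Real.sin θ ^ 2 / kestenDenom q θ)) := by
  rcases hq.eq_or_lt with rfl | hq
  · refine ⟨fun _ => Real.pi⁻¹, continuous_const, fun _ _ => inv_pos.mpr Real.pi_pos, ?_,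
      fun n => ?_, fun h => absurd h (lt_irrefl _)⟩
    · simp [Real.pi_ne_zero]
    · simp only [Real.sqrt_one, mul_one, spherePoly_one_eval]
      rw [intervalIntegral.integral_mul_const, intervalIntegral.integral_const_mul,
        integral_cos_nat_mul]
      simp
  · set u : ℝ → ℝ := fun θ => Real.sin θ ^ 2 / kestenDenom q θ with hu
    have hne : ∀ θ, kestenDenom q θ ≠ 0 := fun θ => (kestenDenom_pos hq θ).ne'
    have huc : Continuous u := by fun_prop (disch := exact hne _)
    have hupos : ∀ θ ∈ Set.Ioo 0 Real.pi, 0 < u θ := fun θ hθ =>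
      div_pos (pow_pos (Real.sin_pos_of_mem_Ioo hθ) 2) (kestenDenom_pos hq θ)
    have hI : 0 < ∫ θ in (0 : ℝ)..Real.pi, u θ :=
      intervalIntegral.intervalIntegral_pos_of_pos_on (huc.intervalIntegrable _ _) hupos
        Real.pi_pos
    refine ⟨fun θ => (∫ θ in (0 : ℝ)..Real.pi, u θ)⁻¹ * u θ, by fun_prop,
      fun θ hθ => mul_pos (inv_pos.mpr hI) (hupos θ hθ), ?_, fun n => ?_,
      fun _ => ⟨_, inv_pos.mpr hI, fun _ => rfl⟩⟩
    · rw [intervalIntegral.integral_const_mul, inv_mul_cancel₀ hI.ne']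
    · set s := Real.sqrt q
      have hs : 0 < s := Real.sqrt_pos.mpr (by linarith)
      have hsq : s ^ 2 = q := Real.sq_sqrt (by linarith)
      have h : ∀ θ : ℝ, (spherePoly q (n + 1)).eval (2 * s * Real.cos θ) *
          ((∫ θ in (0 : ℝ)..Real.pi, u θ)⁻¹ * u θ) =
          (s⁻¹ * s ^ n * (∫ θ in (0 : ℝ)..Real.pi, u θ)⁻¹) *
          (Real.sin θ * (q * Real.sin ((n + 2) * θ) - Real.sin (n * θ)) / kestenDenom q θ) := by
        intro θ
        have key := spherePoly_eval_mul_sin s n θ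
        rw [hsq] at key
        have hs' := hs.ne'
        have := hne θ
        have hI' := hI.ne'
        simp only [hu] at hI' ⊢
        field_simp
        linear_combination Real.sin θ * key
      simp_rw [h]
      rw [intervalIntegral.integral_const_mul, integral_kesten_eq_zero hq, mul_zero]

/-! ### The spectral measure of the Laplacian -/

section Abstract

variable {E : Type*} [NormedAddCommGroup E] [InnerProductSpace ℂ E] [CompleteSpace E]

theorem isSelfAdjoint_smul_one_sub {A : E →L[ℂ] E} (hA : IsSelfAdjoint A) (c : ℝ) :
    IsSelfAdjoint ((c : ℂ) • (1 : E →L[ℂ] E) - A) :=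
  (IsSelfAdjoint.smul (Complex.conj_ofReal c) (IsSelfAdjoint.one _)).sub hA

/-- If `⟨v, P_n(A) v⟩` vanishes for `n ≥ 1`, then `v` has the Kesten–McKay density: the linear
functionals `p ↦ ⟨v, p(A) v⟩` and `p ↦ ∫ p(2√q cos θ) w(θ) dθ` agree on the sphere polynomials, which
span all polynomials. -/
theorem hasSpectralDensity_of_sphereVec {A : E →L[ℂ] E} (hA : IsSelfAdjoint A) {q : ℝ} {v : E}
    (hv : ∀ n, inner ℂ v (sphereVec A q v n) = if n = 0 then 1 else 0) {w : ℝ → ℝ}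
    (hw : Continuous w) (hw1 : ∫ θ in (0 : ℝ)..Real.pi, w θ = 1)
    (hw0 : ∀ n, ∫ θ in (0 : ℝ)..Real.pi,
      (spherePoly q (n + 1)).eval (2 * Real.sqrt q * Real.cos θ) * w θ = 0) (c : ℝ) :
    HasSpectralDensity ((c : ℂ) • (1 : E →L[ℂ] E) - A) v
      (fun θ => c - 2 * Real.sqrt q * Real.cos θ) w 0 Real.pi := by
  have key : ∀ p : Polynomial ℝ, inner ℂ v (Polynomial.aeval A p v) =
      ((∫ θ in (0 : ℝ)..Real.pi, p.eval (2 * Real.sqrt q * Real.cos θ) * w θ : ℝ) : ℂ) := by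
    intro p
    have hp : p ∈ Submodule.span ℝ (Set.range (spherePoly q)) := by
      rw [span_spherePoly]; trivial
    induction hp using Submodule.span_induction with
    | mem p hp =>
      obtain ⟨n, rfl⟩ := hp
      rw [aeval_spherePoly_apply, hv]
      cases n with
      | zero => simp [spherePoly, hw1]
      | succ n => rw [hw0]; simp
    | zero => simp
    | add p q _ _ hp hq =>
      rw [map_add, add_apply, inner_add_right, hp, hq, ← Complex.ofReal_add,
        ← intervalIntegral.integral_add (Continuous.intervalIntegrable (by fun_prop) _ _)
          (Continuous.intervalIntegrable (by fun_prop) _ _)]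
      simp only [Polynomial.eval_add, add_mul]
    | smul c p _ hp =>
      rw [map_smul, smul_apply, ← Complex.coe_smul, inner_smul_right, hp, ← Complex.ofReal_mul,
        ← intervalIntegral.integral_const_mul]
      simp only [Polynomial.eval_smul, smul_eq_mul, mul_assoc]
  refine hasSpectralDensity_of_polynomial (isSelfAdjoint_smul_one_sub hA c) Real.pi_pos.le
    (by fun_prop) hw fun p => ?_
  have h := key (p.comp (Polynomial.C c - Polynomial.X))
  rw [Polynomial.aeval_comp, map_sub, Polynomial.aeval_C, Polynomial.aeval_X,
    Algebra.algebraMap_eq_smul_one, ← Complex.coe_smul] at h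
  simpa [Polynomial.eval_comp] using h

theorem cfc_exp_neg_mul {S : E →L[ℂ] E} (hS : IsSelfAdjoint (-S)) (t : ℝ) :
    cfc (fun x => Real.exp (-t * x)) (-S) = NormedSpace.exp ((t : ℂ) • S) := by
  rw [cfc_comp' Real.exp (fun x => -t * x) (-S), cfc_const_mul_id (-t) _ hS,
    CFC.real_exp_eq_normedSpace_exp (IsSelfAdjoint.smul (IsSelfAdjoint.all _) hS)]
  congr 1
  rw [neg_smul_neg, ← Complex.coe_smul]

end Abstract

theorem isSelfAdjoint_neg_freeLaplacian (d : ℕ) : IsSelfAdjoint (-freeLaplacian d) := by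
  rw [neg_freeLaplacian_eq]
  exact isSelfAdjoint_smul_one_sub (isSelfAdjoint_freeAdjacency d) _

/-- The parametrization `θ ↦ 2d - 2√(2d-1) cos θ` of the spectrum of `-Δ` by `[0, π]`. -/
def spectralParam (d : ℕ) (θ : ℝ) : ℝ := 2 * d - 2 * Real.sqrt (2 * d - 1) * Real.cos θ

@[fun_prop]
theorem continuous_spectralParam (d : ℕ) : Continuous (spectralParam d) := by
  unfold spectralParam; fun_prop

theorem hasSpectralDensity_neg_freeLaplacian {d : ℕ} {w : ℝ → ℝ} (hw : Continuous w)
    (hw1 : ∫ θ in (0 : ℝ)..Real.pi, w θ = 1)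
    (hw0 : ∀ n, ∫ θ in (0 : ℝ)..Real.pi, (spherePoly (2 * d - 1) (n + 1)).eval
      (2 * Real.sqrt (2 * d - 1) * Real.cos θ) * w θ = 0)
    (g : FreeGroup (Fin d)) :
    HasSpectralDensity (-freeLaplacian d) (lp.single 2 g (1 : ℂ)) (spectralParam d) w
      0 Real.pi := by
  rw [neg_freeLaplacian_eq]
  refine hasSpectralDensity_of_sphereVec (isSelfAdjoint_freeAdjacency d) (fun n => ?_) hw hw1 hw0 _
  rw [lp.inner_single_left, sphereVec_single_apply]
  simp [eq_comm]

theorem spectralParam_image {d : ℕ} (hd : 1 ≤ d) : spectralParam d '' Set.Icc 0 Real.pi =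
    Set.Icc (freeGap d) (freeGap d + 4 * Real.sqrt (2 * (d : ℝ) - 1)) := by
  have hd' : (1 : ℝ) ≤ d := by exact_mod_cast hd
  have hs : 0 < Real.sqrt (2 * (d : ℝ) - 1) := Real.sqrt_pos.mpr (by linarith)
  ext x
  simp only [Set.mem_image, Set.mem_Icc, spectralParam, freeGap]
  constructor
  · rintro ⟨θ, -, rfl⟩
    have h1 := Real.cos_le_one θ
    have h2 := Real.neg_one_le_cos θ
    constructor <;> nlinarith
  · rintro ⟨h1, h2⟩
    refine ⟨Real.arccos ((2 * d - x) / (2 * Real.sqrt (2 * d - 1))),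
      ⟨Real.arccos_nonneg _, Real.arccos_le_pi _⟩, ?_⟩
    rw [Real.cos_arccos, mul_div_cancel₀ _ (by positivity)]
    · ring
    · rw [le_div_iff₀ (by positivity)]; linarith
    · rw [div_le_one (by positivity)]; linarith

/-- The inverse of the parametrization is differentiable inside the interval, so preimages of null
sets are null sets. -/
theorem volume_preimage_spectralParam {d : ℕ} (hd : 1 ≤ d) {K : Set ℝ} (hK : volume K = 0) :
    volume (Set.Ioc 0 Real.pi ∩ spectralParam d ⁻¹' K) = 0 := by
  have hd' : (1 : ℝ) ≤ d := by exact_mod_cast hd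
  have hs : 0 < Real.sqrt (2 * (d : ℝ) - 1) := Real.sqrt_pos.mpr (by linarith)
  set c := 2 * Real.sqrt (2 * (d : ℝ) - 1) with hc
  have hc0 : 0 < c := by positivity
  set N := K ∩ (fun x => (2 * (d : ℝ) - x) / c) ⁻¹' Set.Ioo (-1) 1
  have hN : volume ((fun x => Real.arccos ((2 * d - x) / c)) '' N) = 0 := by
    refine addHaar_image_eq_zero_of_differentiableOn_of_addHaar_eq_zero volume
      (fun x hx => ?_) (measure_mono_null Set.inter_subset_left hK)
    have h1 : DifferentiableAt ℝ (fun x => (2 * (d : ℝ) - x) / c) x := by fun_prop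
    exact ((Real.differentiableAt_arccos.mpr ⟨hx.2.1.ne', hx.2.2.ne⟩).comp x h1
      ).differentiableWithinAt
  refine measure_mono_null (t := _ ∪ {Real.pi}) ?_ (measure_union_null hN (by simp))
  rintro θ ⟨hθ, hθK⟩
  rcases hθ.2.eq_or_lt with rfl | hlt
  · right; rfl
  · left
    have hval : (2 * d - spectralParam d θ) / c = Real.cos θ := by
      rw [spectralParam, ← hc]; field_simp; ring
    refine ⟨spectralParam d θ, ⟨hθK, ?_⟩, ?_⟩
    · change (2 * d - spectralParam d θ) / c ∈ Set.Ioo (-1 : ℝ) 1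
      rw [hval]
      constructor
      · rw [← Real.cos_pi]; exact Real.cos_lt_cos_of_nonneg_of_le_pi hθ.1.le le_rfl hlt
      · rw [← Real.cos_zero]; exact Real.cos_lt_cos_of_nonneg_of_le_pi le_rfl hlt.le hθ.1
    · change Real.arccos ((2 * d - spectralParam d θ) / c) = θ
      rw [hval, Real.arccos_cos hθ.1.le hθ.2]

/-! ### The heat kernel -/

theorem freeHeatKernel_eq_integral {d : ℕ} {w : ℝ → ℝ}
    (h : HasSpectralDensity (-freeLaplacian d) (lp.single 2 1 (1 : ℂ)) (spectralParam d) w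
      0 Real.pi) (t : ℝ) :
    freeHeatKernel d t 1 1 =
      ((∫ θ in (0 : ℝ)..Real.pi, Real.exp (-t * spectralParam d θ) * w θ : ℝ) : ℂ) := by
  have hsa := isSelfAdjoint_neg_freeLaplacian d
  rw [← h (fun x => Real.exp (-t * x)) (by fun_prop), lp.inner_single_left]
  rw [cfc_exp_neg_mul hsa, freeHeatKernel]
  simp

/-- Laplace's method at the quadratic zero `θ = 0` of both the phase and the amplitude: after
the substitution `θ = u / r` the integrals converge by domination. -/
theorem exists_tendsto_laplace {q s C : ℝ} (hq : 1 < q) (hs : 0 < s) (hC : 0 < C) :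
    ∃ c > 0, Tendsto (fun r : ℝ => r ^ 3 * ∫ θ in (0 : ℝ)..Real.pi,
      Real.exp (-(r ^ 2 * (s * (1 - Real.cos θ)))) *
        (C * (Real.sin θ ^ 2 / kestenDenom q θ))) atTop (𝓝 c) := by
  have hq1 : 0 < (q - 1) ^ 2 := pow_pos (sub_pos.mpr hq) 2
  have hgauss : ∀ b > 0, IntegrableOn (fun u : ℝ => Real.exp (-(b * u ^ 2)) *
      (C * (u ^ 2 / (q - 1) ^ 2))) (Set.Ioi 0) := by
    intro b hb
    have h := (integrable_rpow_mul_exp_neg_mul_sq hb (s := 2) (by norm_num)).const_mul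
      (C / (q - 1) ^ 2)
    refine (h.congr (.of_forall fun u => ?_)).integrableOn
    simp only [Real.rpow_two, neg_mul]
    ring
  set G : ℝ → ℝ := fun u => Real.exp (-(s / 2 * u ^ 2)) * (C * (u ^ 2 / (q - 1) ^ 2)) with hG
  set F : ℝ → ℝ → ℝ := fun r u => Real.exp (-(r ^ 2 * (s * (1 - Real.cos (u / r))))) *
    (C * ((r * Real.sin (u / r)) ^ 2 / kestenDenom q (u / r))) with hF
  refine ⟨∫ u in Set.Ioi 0, G u, ?_, ?_⟩
  · refine (setIntegral_pos_iff_support_of_nonneg_ae (.of_forall fun u => ?_)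
      (hgauss _ (by positivity))).mpr ?_
    · rw [Pi.zero_apply]; positivity
    · refine lt_of_lt_of_le (b := volume (Set.Ioi (0 : ℝ))) (by simp) (measure_mono fun u hu => ?_)
      have : 0 < u := hu
      refine ⟨?_, hu⟩
      rw [Function.mem_support]
      positivity
  · have hsubst : ∀ᶠ r : ℝ in atTop, ∫ u in Set.Ioi 0, (Set.Ioc 0 (r * Real.pi)).indicator (F r) u =
        r ^ 3 * ∫ θ in (0 : ℝ)..Real.pi, Real.exp (-(r ^ 2 * (s * (1 - Real.cos θ)))) *
        (C * (Real.sin θ ^ 2 / kestenDenom q θ)) := by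
      filter_upwards [eventually_gt_atTop 0] with r hr
      rw [setIntegral_indicator measurableSet_Ioc,
        Set.inter_eq_self_of_subset_right Set.Ioc_subset_Ioi_self,
        ← intervalIntegral.integral_of_le (by positivity)]
      have h := intervalIntegral.integral_comp_div (a := 0) (b := r * Real.pi)
        (fun θ => r ^ 2 * (Real.exp (-(r ^ 2 * (s * (1 - Real.cos θ)))) *
          (C * (Real.sin θ ^ 2 / kestenDenom q θ)))) hr.ne'
      rw [zero_div, mul_div_cancel_left₀ _ hr.ne', intervalIntegral.integral_const_mul,
        intervalIntegral.integral_const_mul, smul_eq_mul] at h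
      rw [show r ^ 3 = r * r ^ 2 by ring, mul_assoc, ← h,
        ← intervalIntegral.integral_const_mul]
      refine intervalIntegral.integral_congr fun u _ => ?_
      simp only [hF]
      ring
    refine Tendsto.congr' hsubst ?_
    refine tendsto_integral_filter_of_dominated_convergence
      (fun u => Real.exp (-(2 * s / Real.pi ^ 2 * u ^ 2)) * (C * (u ^ 2 / (q - 1) ^ 2)))
      ?_ ?_ (hgauss _ (by positivity)) ?_
    · refine .of_forall fun r => (Measurable.indicator ?_ measurableSet_Ioc).aestronglyMeasurable
      have := (continuous_kestenDenom q).measurable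
      simp only [hF]
      fun_prop
    · filter_upwards [eventually_gt_atTop 0] with r hr
      refine (ae_restrict_mem measurableSet_Ioi).mono fun u hu => ?_
      have hu0 : 0 < u := hu
      by_cases hmem : u ∈ Set.Ioc 0 (r * Real.pi)
      · rw [Set.indicator_of_mem hmem]
        have hD := kestenDenom_pos hq (u / r)
        have hθ : |u / r| ≤ Real.pi := by
          rw [abs_of_pos (by positivity), div_le_iff₀ hr]; linarith [hmem.2]
        have hcos := Real.cos_le_one_sub_mul_cos_sq hθ
        have hsin : (r * Real.sin (u / r)) ^ 2 ≤ u ^ 2 := by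
          have h1 : |Real.sin (u / r)| ≤ |u / r| := Real.abs_sin_le_abs
          rw [sq_le_sq, abs_mul]
          calc |r| * |Real.sin (u / r)| ≤ |r| * |u / r| := by gcongr
            _ = |u| := by rw [← abs_mul, mul_div_cancel₀ _ hr.ne']
        have hexp : 2 * s / Real.pi ^ 2 * u ^ 2 ≤ r ^ 2 * (s * (1 - Real.cos (u / r))) := by
          have h1 : 2 / Real.pi ^ 2 * (u / r) ^ 2 ≤ 1 - Real.cos (u / r) := by linarith
          calc 2 * s / Real.pi ^ 2 * u ^ 2 = r ^ 2 * (s * (2 / Real.pi ^ 2 * (u / r) ^ 2)) := by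
                field_simp
            _ ≤ _ := by gcongr
        rw [Real.norm_eq_abs, abs_of_nonneg (by simp only [hF]; positivity)]
        simp only [hF]
        gcongr
        exact sq_le_kestenDenom (by linarith) _
      · rw [Set.indicator_of_notMem hmem, norm_zero]
        positivity
    · refine (ae_restrict_mem measurableSet_Ioi).mono fun u hu => ?_
      have hu0 : 0 < u := hu
      -- `sin x = x sinc x` and `1 - cos x = 2 sin² (x/2)` give the limits of phase and amplitude.
      have hsc : ∀ v : ℝ, Tendsto (fun r : ℝ => r * Real.sin (v / r)) atTop (𝓝 v) := by
        intro v
        have h1 : Tendsto (fun r : ℝ => v * Real.sinc (v / r)) atTop (𝓝 (v * Real.sinc 0)) :=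
          ((Real.continuous_sinc.tendsto 0).comp
            (tendsto_const_nhds.div_atTop tendsto_id)).const_mul v
        rw [Real.sinc_zero, mul_one] at h1
        refine h1.congr' ?_
        filter_upwards [eventually_gt_atTop 0] with r hr
        by_cases hv : v = 0
        · simp [hv]
        · rw [Real.sinc_of_ne_zero (by positivity)]
          field_simp
      have hD : Tendsto (fun r : ℝ => kestenDenom q (u / r)) atTop (𝓝 ((q - 1) ^ 2)) := by
        have h0 : kestenDenom q 0 = (q - 1) ^ 2 := by simp [kestenDenom]; ring
        rw [← h0]
        exact ((continuous_kestenDenom q).tendsto 0).comp (tendsto_const_nhds.div_atTop tendsto_id)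
      have hlim : Tendsto (fun r => F r u) atTop (𝓝 (G u)) := by
        refine Tendsto.mul ?_ ((((hsc u).pow 2).div hD hq1.ne').const_mul C)
        have h1 : ∀ r : ℝ, -(r ^ 2 * (s * (1 - Real.cos (u / r)))) =
            -(2 * s * (r * Real.sin (u / 2 / r)) ^ 2) := by
          intro r
          have h2 : u / r = 2 * (u / 2 / r) := by ring
          rw [h2, Real.cos_two_mul, Real.cos_sq']
          ring
        simp_rw [h1]
        have h3 := (Real.continuous_exp.tendsto _).comp
          ((((hsc (u / 2)).pow 2).const_mul (2 * s)).neg)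
        rw [show 2 * s * (u / 2) ^ 2 = s / 2 * u ^ 2 by ring] at h3
        exact h3
      refine hlim.congr' ?_
      filter_upwards [eventually_ge_atTop (u / Real.pi)] with r hr
      rw [Set.indicator_of_mem]
      exact ⟨hu0, (div_le_iff₀ Real.pi_pos).mp hr⟩

/-! ### The bottom of the spectrum and the heat kernel asymptotics -/

theorem freeGap_nonneg (d : ℕ) : 0 ≤ freeGap d := by
  have h := Real.sqrt_le_sqrt (show 2 * (d : ℝ) - 1 ≤ d ^ 2 by nlinarith [sq_nonneg ((d : ℝ) - 1)])
  rw [Real.sqrt_sq (Nat.cast_nonneg d)] at h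
  unfold freeGap
  linarith

theorem theorem7 (d : ℕ) (hd : 1 ≤ d) :
    (spectrum ℂ (-freeLaplacian d) =
        (fun x : ℝ => (x : ℂ)) ''
          Set.Icc (freeGap d) (freeGap d + 4 * Real.sqrt (2 * (d : ℝ) - 1)) ∧
      HasPurelyACSpectrum (-freeLaplacian d) ∧
      0 ≤ freeGap d) ∧
    (∃ c₁ : ℝ, 0 < c₁ ∧
      Filter.Tendsto (fun t : ℝ => freeHeatKernel d t 1 1)
        (nhdsWithin 0 (Set.Ioi 0)) (nhds (c₁ : ℂ))) ∧
    (2 ≤ d → ∃ c₂ : ℝ, 0 < c₂ ∧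
      Asymptotics.IsEquivalent Filter.atTop
        (fun t : ℝ => freeHeatKernel d t 1 1)
        (fun t : ℝ => ((c₂ * (Real.exp (-freeGap d * t) / t ^ (3 / 2 : ℝ)) : ℝ) : ℂ))) := by
  have hd' : (1 : ℝ) ≤ d := by exact_mod_cast hd
  obtain ⟨w, hw, hwpos, hw1, hw0, hwC⟩ :=
    exists_kesten_weight (q := 2 * (d : ℝ) - 1) (by linarith)
  have hdens := hasSpectralDensity_neg_freeLaplacian hw hw1 hw0
  have hsa := isSelfAdjoint_neg_freeLaplacian d
  have hheat := freeHeatKernel_eq_integral (hdens 1)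
  have : Nontrivial (EllTwo (FreeGroup (Fin d))) :=
    ⟨lp.single 2 1 (1 : ℂ), 0, fun h => by
      simpa using congrArg (fun ψ : EllTwo (FreeGroup (Fin d)) => ψ 1) h⟩
  refine ⟨⟨?_, ?_, freeGap_nonneg d⟩, ⟨1, one_pos, ?_⟩, fun hd2 => ?_⟩
  · rw [← spectralParam_image hd, ← spectrum_eq_image hsa (span_single_dense _) hdens Real.pi_pos
      (continuous_spectralParam d) hw hwpos]
    exact hsa.spectrumRestricts.algebraMap_image.symm
  · exact hasPurelyACSpectrum_of_density hsa (span_single_dense _) hdens Real.pi_pos.le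
      (continuous_spectralParam d) hw fun K hK => volume_preimage_spectralParam hd hK
  · simp_rw [hheat]
    have hcont : Continuous fun t : ℝ =>
        ∫ θ in (0 : ℝ)..Real.pi, Real.exp (-t * spectralParam d θ) * w θ :=
      intervalIntegral.continuous_parametric_intervalIntegral_of_continuous' (by fun_prop) _ _
    have h := hcont.tendsto 0
    simp only [neg_zero, zero_mul, Real.exp_zero, one_mul, hw1] at h
    exact ((Complex.continuous_ofReal.tendsto 1).comp h).mono_left nhdsWithin_le_nhds
  · have hd2' : (2 : ℝ) ≤ d := by exact_mod_cast hd2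
    obtain ⟨C, hC, hwC⟩ := hwC (by linarith)
    have hs : 0 < 2 * Real.sqrt (2 * (d : ℝ) - 1) := by
      have := Real.sqrt_pos.mpr (show 0 < 2 * (d : ℝ) - 1 by linarith)
      positivity
    obtain ⟨c, hc, hlim⟩ :=
      exists_tendsto_laplace (q := 2 * (d : ℝ) - 1) (by linarith) hs hC
    refine ⟨c, hc, ?_⟩
    have hlim' := (hlim.comp Real.tendsto_sqrt_atTop).div_const c
    rw [div_self hc.ne'] at hlim'
    rw [Asymptotics.isEquivalent_iff_tendsto_one]
    · refine ((Complex.continuous_ofReal.tendsto 1).comp hlim').congr' ?_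
      filter_upwards [eventually_gt_atTop 0] with t ht
      rw [Pi.div_apply, hheat, ← Complex.ofReal_div]
      have h1 : ∀ θ, Real.exp (-t * spectralParam d θ) * w θ = Real.exp (-freeGap d * t) *
          (Real.exp (-(Real.sqrt t ^ 2 * (2 * Real.sqrt (2 * (d : ℝ) - 1) * (1 - Real.cos θ)))) *
            (C * (Real.sin θ ^ 2 / kestenDenom (2 * (d : ℝ) - 1) θ))) := by
        intro θ
        rw [hwC, Real.sq_sqrt ht.le, ← mul_assoc (Real.exp (-freeGap d * t)), ← Real.exp_add]
        congr 2
        rw [spectralParam, freeGap]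
        ring
      have h2 : t ^ (3 / 2 : ℝ) = Real.sqrt t ^ 3 := by
        rw [Real.sqrt_eq_rpow, ← Real.rpow_natCast, ← Real.rpow_mul ht.le]
        norm_num
      simp_rw [h1]
      rw [intervalIntegral.integral_const_mul, h2]
      have h3 := Real.sqrt_pos.mpr ht
      have h4 := Real.exp_pos (-freeGap d * t)
      have h5 : ∀ I : ℝ, Real.sqrt t ^ 3 * I / c = Real.exp (-freeGap d * t) * I /
          (c * (Real.exp (-freeGap d * t) / Real.sqrt t ^ 3)) := fun I => by field_simp
      exact congrArg Complex.ofReal (h5 _)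
    · filter_upwards [eventually_gt_atTop 0] with t ht
      rw [Ne, Complex.ofReal_eq_zero]
      positivity

end
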